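/- The Euler polynomials $E_n(x)$ are defined by the generating function $\frac{2e^{xt}}{e^t+1}=\sum_{n=0}^\infty E_n(x)\frac{t^n}{n!}$. For a sequence $c=(c_0,c_1,\ldots)$ and an integer $n\ge 0$ let $H_n(c_k)=\det_{0\le i,j\le n}(c_{i+j})$ denote its $n$th Hankel determinant, the determinant of an $(n+1)\times(n+1)$ matrix, and let $\mathcal{H}_n=\sum_{j=1}^n\frac1j$ be the $n$th harmonic number ($\mathcal{H}_0=0$). Let the sequence $(b_0,b_1,\ldots)$ be defined by $b_0=0$ and $b_k=E_{2k-1}(1)$ for $k\ge 1$. Then for all integers $n\ge 0$, $$H_n(b_k)=(-1)^n\,\frac{2^{2n+1}}{(2n+1)!}\cdot\mathcal{H}_n\cdot H_n\big(E_{2k+1}(1)\big).$$ -/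

import Mathlib

/-- The Hankel determinant `H_n(c) = det (c_{i+j})_{0 ≤ i, j ≤ n}` of a sequence `c`; the matrix
has size `(n + 1) × (n + 1)`. -/
def hankelDet {R : Type*} [CommRing R] (c : ℕ → R) (n : ℕ) : R :=
  Matrix.det (Matrix.of fun i j : Fin (n + 1) => c ((i : ℕ) + (j : ℕ)))

/-- The power series `2 / (e^t + 1)` in `ℚ⟦t⟧`. The constant coefficient of `e^t + 1` is `2`, so
the inverse is the true inverse of power series. -/
noncomputable def eulerSeries : PowerSeries ℚ :=
  2 * (PowerSeries.exp ℚ + 1)⁻¹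

/-- The Euler polynomial `E_n(x)`, defined by `2 e^{xt} / (e^t + 1) = ∑ E_n(x) t^n / n!`:
it is `n!` times the coefficient of `t^n` in the power series `2 / (e^t + 1) * e^{xt}` over
the polynomial ring `ℚ[x]`. -/
noncomputable def eulerPolynomial (n : ℕ) : Polynomial ℚ :=
  (Nat.factorial n : Polynomial ℚ) *
    PowerSeries.coeff n
      (PowerSeries.map Polynomial.C eulerSeries *
        PowerSeries.rescale (Polynomial.X : Polynomial ℚ) (PowerSeries.exp (Polynomial ℚ)))

theorem eulerSeries_mul_exp_add_one : eulerSeries * (PowerSeries.exp ℚ + 1) = 2 := by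
  have h : PowerSeries.constantCoeff (PowerSeries.exp ℚ + 1) ≠ 0 := by
    simp
  rw [eulerSeries, mul_assoc, PowerSeries.inv_mul_cancel _ h, mul_one]

/-- The generating function identity
`(∑ E_n(x) t^n / n!) * (e^t + 1) = 2 e^{xt}` in `ℚ[x]⟦t⟧`. -/
theorem eulerPolynomial_generating_function :
    PowerSeries.mk (fun n => (n.factorial : ℚ)⁻¹ • eulerPolynomial n) *
        (PowerSeries.exp (Polynomial ℚ) + 1) =
      2 * PowerSeries.rescale (Polynomial.X : Polynomial ℚ)
        (PowerSeries.exp (Polynomial ℚ)) := by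
  have h1 : PowerSeries.mk (fun n => (n.factorial : ℚ)⁻¹ • eulerPolynomial n) =
      PowerSeries.map Polynomial.C eulerSeries *
        PowerSeries.rescale (Polynomial.X : Polynomial ℚ)
          (PowerSeries.exp (Polynomial ℚ)) := by
    ext1 n
    have hn : (n.factorial : ℚ) ≠ 0 := by exact_mod_cast n.factorial_ne_zero
    rw [PowerSeries.coeff_mk, eulerPolynomial, ← nsmul_eq_mul, ← Nat.cast_smul_eq_nsmul ℚ,
      smul_smul, inv_mul_cancel₀ hn, one_smul]
  have h2 : PowerSeries.map Polynomial.C eulerSeries *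
      (PowerSeries.exp (Polynomial ℚ) + 1) = 2 := by
    have := congrArg (PowerSeries.map (Polynomial.C : ℚ →+* Polynomial ℚ))
      eulerSeries_mul_exp_add_one
    rwa [map_mul, map_add, map_one, PowerSeries.map_exp, map_ofNat] at this
  rw [h1, mul_right_comm, h2]

/-! With `τ = tanh (t / 2)`, `E_{n+1}(1)` is half of `a(n, 0)`, where `a(n, k)` (`tanhArray`) is the
value at 0 of `D^n ((1 - τ²) τ^k)`. Since `2τ' = 1 - τ²`, these numbers obey a three-term recursion,
which is symmetric for the weights `(-1)^k (k + 1)`; hence `a(i + j, 0) = ∑ (-1)^k (k + 1) a(i, k)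
a(j, k)` (`sum_tanhArray_mul`). By parity the even and odd indices separate, and each gives a
factorization `L D Lᵀ` with `L` triangular.

The even part evaluates `H_n(E_{2k+1}(1))`. The odd part factors the Hankel matrix of `b` without
its first row and column. The remaining border entries are the row sums of `L`, so the whole matrix
is congruent to a diagonal matrix bordered by ones with corner 0. Its Schur complement yields the
harmonic number. -/

open PowerSeries in
/-- The power series `tanh (t / 2) = 2 e^t / (e^t + 1) - 1`. -/
noncomputable def tanhHalf : PowerSeries ℚ :=
  eulerSeries * exp ℚ - 1

open PowerSeries in
theorem eulerSeries_eq_one_sub_tanhHalf : eulerSeries = 1 - tanhHalf := by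
  have h := eulerSeries_mul_exp_add_one
  rw [tanhHalf]
  linear_combination h

open PowerSeries in
theorem constantCoeff_tanhHalf : constantCoeff tanhHalf = 0 := by
  have h := congrArg constantCoeff eulerSeries_mul_exp_add_one
  have h2 : constantCoeff (2 : PowerSeries ℚ) = 2 := map_ofNat _ 2
  simp only [map_mul, map_add, constantCoeff_exp, map_one, h2] at h
  simp only [tanhHalf, map_sub, map_mul, constantCoeff_exp, map_one]
  linarith

open PowerSeries in
theorem two_mul_derivative_tanhHalf : 2 * derivative ℚ tanhHalf = 1 - tanhHalf ^ 2 := by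
  have h := eulerSeries_mul_exp_add_one
  have h1 := congrArg (derivative ℚ) h
  have h2 : derivative ℚ (2 : PowerSeries ℚ) = 0 := (derivative ℚ).map_natCast 2
  have h3 : derivative ℚ (exp ℚ) = exp ℚ := derivative_exp ℚ
  simp only [Derivation.leibniz, map_add, h3, smul_eq_mul, Derivation.map_one_eq_zero, h2,
    add_zero] at h1
  have h4 : derivative ℚ tanhHalf = - derivative ℚ eulerSeries := by
    rw [eulerSeries_eq_one_sub_tanhHalf, map_sub, Derivation.map_one_eq_zero, zero_sub, neg_neg]
  have h5 : tanhHalf = 1 - eulerSeries := by rw [eulerSeries_eq_one_sub_tanhHalf]; ring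
  rw [h4, h5]
  linear_combination (derivative ℚ eulerSeries + eulerSeries) * h - eulerSeries * h1

/-- The number `D^n ((1 - τ ^ 2) τ ^ k)` at `0` for `τ = tanh (t / 2)`, defined recursively. -/
def tanhArray : ℕ → ℕ → ℚ
  | 0, k => if k = 0 then 1 else 0
  -- At `k = 0` the truncated `k - 1` is harmless: its coefficient vanishes.
  | n + 1, k => k / 2 * tanhArray n (k - 1) - (k + 2) / 2 * tanhArray n (k + 1)

open PowerSeries in
theorem constantCoeff_iterate_derivative_tanhHalf (n k : ℕ) :
    constantCoeff ((derivative ℚ)^[n] ((1 - tanhHalf ^ 2) * tanhHalf ^ k)) = tanhArray n k := by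
  induction n generalizing k with
  | zero =>
    simp [tanhArray, constantCoeff_tanhHalf, zero_pow_eq]
  | succ n ih =>
    have h : derivative ℚ ((1 - tanhHalf ^ 2) * tanhHalf ^ k) =
        ((k : ℚ) / 2) • ((1 - tanhHalf ^ 2) * tanhHalf ^ (k - 1)) -
          (((k : ℚ) + 2) / 2) • ((1 - tanhHalf ^ 2) * tanhHalf ^ (k + 1)) := by
      have hd := two_mul_derivative_tanhHalf
      have h2 : (C (1 / 2 : ℚ)) * 2 = 1 := by
        rw [← map_ofNat C 2, ← map_mul]; norm_num
      have hd' : derivative ℚ tanhHalf = C (1 / 2 : ℚ) * (1 - tanhHalf ^ 2) := by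
        linear_combination C (1 / 2 : ℚ) * hd - derivative ℚ tanhHalf * h2
      have hc₁ : C ((k : ℚ) / 2) = C (1 / 2 : ℚ) * k := by
        rw [← map_natCast C, ← map_mul]; ring_nf
      have hc₂ : C (((k : ℚ) + 2) / 2) = C (1 / 2 : ℚ) * (k + 2) := by
        rw [← map_natCast C, ← map_ofNat C 2, ← map_add, ← map_mul]; ring_nf
      simp only [smul_eq_C_mul, hc₁, hc₂, Derivation.leibniz, Derivation.leibniz_pow, map_sub,
        Derivation.map_one_eq_zero, smul_eq_mul, nsmul_eq_mul, hd']
      rcases k with _ | k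
      · simp only [Nat.cast_zero, Nat.cast_ofNat]
        ring
      · simp only [Nat.cast_add, Nat.cast_one, Nat.cast_ofNat, Nat.add_sub_cancel]
        ring
    rw [Function.iterate_succ_apply, h, constantCoeff_iterate_derivative, map_sub, coeff_smul,
      coeff_smul, tanhArray, ← ih, ← ih, constantCoeff_iterate_derivative,
      constantCoeff_iterate_derivative]
    simp only [smul_eq_mul]
    ring

open PowerSeries in
theorem eval_one_eulerPolynomial (n : ℕ) :
    (eulerPolynomial n).eval 1 = n.factorial * coeff n (eulerSeries * exp ℚ) := by
  rw [eulerPolynomial, ← Polynomial.coe_evalRingHom, map_mul, map_natCast, ← coeff_map, map_mul]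
  congr 3
  · ext m; simp
  · ext m; simp [coeff_exp]

open PowerSeries in
theorem eval_one_eulerPolynomial_succ (n : ℕ) :
    (eulerPolynomial (n + 1)).eval 1 = tanhArray n 0 / 2 := by
  have h : eulerSeries * exp ℚ = tanhHalf + 1 := by rw [tanhHalf]; ring
  have hd : derivative ℚ (eulerSeries * exp ℚ) = (1 / 2 : ℚ) • (1 - tanhHalf ^ 2) := by
    rw [← two_mul_derivative_tanhHalf, h, map_add, Derivation.map_one_eq_zero, add_zero,
      two_mul, smul_add, ← add_smul]
    norm_num
  rw [eval_one_eulerPolynomial, ← constantCoeff_iterate_derivative,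
    Function.iterate_succ_apply, hd, constantCoeff_iterate_derivative,
    ← constantCoeff_iterate_derivative_tanhHalf, constantCoeff_iterate_derivative, coeff_smul]
  simp only [pow_zero, mul_one, smul_eq_mul]
  ring

theorem tanhArray_eq_zero_of_lt {n k : ℕ} (h : n < k) : tanhArray n k = 0 := by
  induction n generalizing k with
  | zero => simp [tanhArray, h.ne']
  | succ n ih => rw [tanhArray, ih (by omega), ih (by omega)]; ring

theorem tanhArray_eq_zero_of_odd {n k : ℕ} (h : Odd (n + k)) : tanhArray n k = 0 := by
  induction n generalizing k with
  | zero =>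
    have : k ≠ 0 := by rintro rfl; simp at h
    simp [tanhArray, this]
  | succ n ih =>
    rw [tanhArray, ih (k := k + 1) (by convert h using 1; ring)]
    rcases k with _ | k
    · simp
    · rw [ih (by
        rw [Nat.add_sub_cancel]
        rw [show n + 1 + (k + 1) = n + k + 2 by ring] at h
        simpa [parity_simps] using h)]
      ring

theorem tanhArray_self (n : ℕ) : tanhArray n n = n.factorial / 2 ^ n := by
  induction n with
  | zero => simp [tanhArray]
  | succ n ih =>
    rw [tanhArray, Nat.add_sub_cancel, ih, tanhArray_eq_zero_of_lt (by omega : n < n + 1 + 1),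
      Nat.factorial_succ]
    push_cast
    field_simp
    ring

/-- The recursion operator is self-adjoint for the weights `(-1)^k (k + 1)`, up to a boundary term
at the cutoff `N`. -/
theorem sum_tanhArray_mul_succ (i j N : ℕ) :
    ∑ k ∈ Finset.range (N + 1), (-1) ^ k * (k + 1 : ℚ) * tanhArray i k * tanhArray (j + 1) k =
      ∑ k ∈ Finset.range (N + 1), (-1) ^ k * (k + 1 : ℚ) * tanhArray (i + 1) k * tanhArray j k -
        (-1) ^ N * ((N + 1) * (N + 2) / 2) *
          (tanhArray i N * tanhArray j (N + 1) - tanhArray i (N + 1) * tanhArray j N) := by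
  induction N with
  | zero => simp [tanhArray]; ring
  | succ N ih =>
    rw [Finset.sum_range_succ, ih, Finset.sum_range_succ _ (N + 1)]
    simp only [tanhArray, Nat.add_sub_cancel]
    push_cast
    ring

/-- The Stieltjes factorization of the Hankel matrix of the sequence `D^n (1 - τ ^ 2)` at `0`. -/
theorem sum_tanhArray_mul (i j N : ℕ) (h : j < N) :
    ∑ k ∈ Finset.range N, (-1) ^ k * (k + 1 : ℚ) * tanhArray i k * tanhArray j k =
      tanhArray (i + j) 0 := by
  obtain ⟨N, rfl⟩ : ∃ M, N = M + 1 := ⟨N - 1, by omega⟩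
  induction j generalizing i with
  | zero =>
    rw [Finset.sum_range_succ']
    simp [tanhArray]
  | succ j ih =>
    rw [sum_tanhArray_mul_succ, ih _ (by omega), tanhArray_eq_zero_of_lt (by omega : j < N),
      tanhArray_eq_zero_of_lt (by omega : j < N + 1), add_right_comm i 1 j, add_assoc i j 1]
    ring

theorem sum_range_two_mul {M : Type*} [AddCommMonoid M] (f : ℕ → M) (n : ℕ) :
    ∑ k ∈ Finset.range (2 * n), f k =
      ∑ k ∈ Finset.range n, f (2 * k) + ∑ k ∈ Finset.range n, f (2 * k + 1) := by
  induction n with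
  | zero => simp
  | succ n ih =>
    rw [mul_add_one, Finset.sum_range_succ, Finset.sum_range_succ, ih, Finset.sum_range_succ,
      Finset.sum_range_succ]
    abel

theorem sum_tanhArray_even (i j N : ℕ) (h : j < N) :
    ∑ k ∈ Finset.range N, (2 * k + 1 : ℚ) * tanhArray (2 * i) (2 * k) * tanhArray (2 * j) (2 * k) =
      tanhArray (2 * (i + j)) 0 := by
  rw [mul_add, ← sum_tanhArray_mul (2 * i) (2 * j) (2 * N) (by omega), sum_range_two_mul,
    Finset.sum_eq_zero (s := Finset.range N) (f := fun k => _ * tanhArray (2 * j) (2 * k + 1)),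
    add_zero]
  · refine Finset.sum_congr rfl fun k _ => ?_
    rw [pow_mul]
    norm_num
  · intro k _
    rw [tanhArray_eq_zero_of_odd (n := 2 * j) ⟨j + k, by ring⟩, mul_zero]

theorem sum_tanhArray_odd (i j N : ℕ) (h : j < N) :
    ∑ k ∈ Finset.range N, (-(2 * k + 2) : ℚ) * tanhArray (2 * i + 1) (2 * k + 1) *
        tanhArray (2 * j + 1) (2 * k + 1) =
      tanhArray (2 * (i + j + 1)) 0 := by
  rw [show 2 * (i + j + 1) = (2 * i + 1) + (2 * j + 1) by ring,
    ← sum_tanhArray_mul (2 * i + 1) (2 * j + 1) (2 * N) (by omega), sum_range_two_mul,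
    Finset.sum_eq_zero (s := Finset.range N) (f := fun k => _ * tanhArray (2 * j + 1) (2 * k)),
    zero_add]
  · refine Finset.sum_congr rfl fun k _ => ?_
    rw [pow_succ, pow_mul]
    push_cast
    ring
  · intro k _
    rw [tanhArray_eq_zero_of_odd (n := 2 * j + 1) ⟨j + k, by ring⟩, mul_zero]

/-- The recursion makes the sum telescope. It expresses the border of the Hankel matrix through its
odd block. -/
theorem sum_tanhArray_two_mul_add_one (j N : ℕ) (h : j < N) :
    ∑ k ∈ Finset.range N, tanhArray (2 * j + 1) (2 * k + 1) = tanhArray (2 * j) 0 / 2 := by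
  have key : ∀ M : ℕ, ∑ k ∈ Finset.range M, tanhArray (2 * j + 1) (2 * k + 1) =
      tanhArray (2 * j) 0 / 2 - (2 * M + 1) / 2 * tanhArray (2 * j) (2 * M) := by
    intro M
    induction M with
    | zero => simp; ring
    | succ M ih =>
      rw [Finset.sum_range_succ, ih, tanhArray, Nat.add_sub_cancel]
      push_cast
      ring_nf
  rw [key, tanhArray_eq_zero_of_lt (by omega : 2 * j < 2 * N), mul_zero, sub_zero]

theorem hankelDet_eulerPolynomial_odd (n : ℕ) :
    hankelDet (fun k => (eulerPolynomial (2 * k + 1)).eval 1) n =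
      ∏ k ∈ Finset.range (n + 1), (2 * k + 1 : ℚ) / 2 * ((2 * k).factorial / 2 ^ (2 * k)) ^ 2 := by
  let A : Matrix (Fin (n + 1)) (Fin (n + 1)) ℚ := Matrix.of fun i k => tanhArray (2 * i) (2 * k)
  -- Half the weight `2k + 1`, because `E_{2k+1}(1)` is half an array entry.
  let d : Fin (n + 1) → ℚ := fun k => (2 * (k : ℕ) + 1) / 2
  have hA : A.det = ∏ k : Fin (n + 1), ((2 * (k : ℕ)).factorial / 2 ^ (2 * (k : ℕ)) : ℚ) := by
    rw [Matrix.det_of_isLowerTriangular]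
    · exact Finset.prod_congr rfl fun k _ => tanhArray_self _
    · intro i k hik
      have : (i : ℕ) < k := hik
      exact tanhArray_eq_zero_of_lt (by omega)
  have hM : (Matrix.of fun i j : Fin (n + 1) =>
      (eulerPolynomial (2 * ((i : ℕ) + (j : ℕ)) + 1)).eval 1) =
        A * Matrix.diagonal d * A.transpose := by
    ext i j
    rw [Matrix.of_apply, eval_one_eulerPolynomial_succ, Matrix.mul_apply,
      ← sum_tanhArray_even i j (n + 1) j.2, Finset.sum_div, Finset.sum_range]
    refine Finset.sum_congr rfl fun k _ => ?_
    rw [Matrix.mul_diagonal]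
    simp only [A, d, Matrix.of_apply, Matrix.transpose_apply]
    ring
  rw [hankelDet, hM, Matrix.det_mul, Matrix.det_mul, Matrix.det_transpose, Matrix.det_diagonal,
    hA, Finset.prod_range, Finset.prod_mul_distrib, Finset.prod_pow]
  ring

theorem det_bordered_diagonal {n : ℕ} (d : Fin n → ℚ) (hd : ∀ k, d k ≠ 0) :
    (Matrix.fromBlocks (Matrix.diagonal d) (Matrix.of fun _ (_ : PUnit.{1}) => (1 : ℚ))
      (Matrix.of fun _ _ => 1) 0).det = -((∏ k, d k) * ∑ k, (d k)⁻¹) := by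
  let _ : Invertible d := ⟨fun k => (d k)⁻¹, by ext k; simp [hd], by ext k; simp [hd]⟩
  let _ : Invertible (Matrix.diagonal d) := Matrix.diagonalInvertible d
  rw [Matrix.det_fromBlocks₁₁, Matrix.det_diagonal, Matrix.invOf_diagonal_eq,
    Matrix.det_unique]
  have h : ∀ k, (⅟d) k = (d k)⁻¹ := fun _ => rfl
  simp [Matrix.mul_apply, Matrix.diagonal_apply, h]

theorem hankelDet_eulerPolynomial_shift (b : ℕ → ℚ) (hb₀ : b 0 = 0)
    (hb : ∀ k : ℕ, b (k + 1) = (eulerPolynomial (2 * k + 1)).eval 1) (n : ℕ) :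
    hankelDet b n = (-1) ^ n * n.factorial * harmonic n *
      ∏ k ∈ Finset.range n, (((2 * k + 1).factorial : ℚ) / 2 ^ (2 * k + 1)) ^ 2 := by
  let B : Matrix (Fin n) (Fin n) ℚ := Matrix.of fun i k => tanhArray (2 * i + 1) (2 * k + 1)
  let d : Fin n → ℚ := fun k => -((k : ℕ) + 1)
  have hd : ∀ k, d k ≠ 0 := fun k => neg_ne_zero.2 (Nat.cast_add_one_ne_zero _)
  have hB : B.det =
      ∏ k : Fin n, ((2 * (k : ℕ) + 1).factorial / 2 ^ (2 * (k : ℕ) + 1) : ℚ) := by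
    rw [Matrix.det_of_isLowerTriangular]
    · exact Finset.prod_congr rfl fun k _ => tanhArray_self _
    · intro i k hik
      have : (i : ℕ) < k := hik
      exact tanhArray_eq_zero_of_lt (by omega)
  -- Moves index 0, which carries the zero corner, to the last block.
  let e : Fin n ⊕ PUnit.{1} ≃ Fin (n + 1) :=
    ((finSuccEquiv n).trans (Equiv.optionEquivSumPUnit (Fin n))).symm
  have he : ∀ i, e (Sum.inl i) = i.succ := fun i => by simp [e]
  have he₀ : ∀ i, e (Sum.inr i) = 0 := fun i => by simp [e]
  have hrow : ∀ j : Fin n, b ((j : ℕ) + 1) = ∑ k, B j k := fun j => by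
    rw [hb, eval_one_eulerPolynomial_succ, ← sum_tanhArray_two_mul_add_one j n j.2,
      Finset.sum_range]
    rfl
  have hM : (Matrix.of fun i j : Fin (n + 1) => b ((i : ℕ) + (j : ℕ))).submatrix e e =
      Matrix.fromBlocks B 0 0 1 * Matrix.fromBlocks (Matrix.diagonal d)
        (Matrix.of fun _ (_ : PUnit.{1}) => (1 : ℚ)) (Matrix.of fun _ _ => 1) 0 *
        (Matrix.fromBlocks B 0 0 1).transpose := by
    simp only [Matrix.fromBlocks_transpose, Matrix.fromBlocks_multiply, Matrix.zero_mul,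
      Matrix.mul_zero, add_zero, zero_add, Matrix.transpose_zero, Matrix.transpose_one,
      Matrix.one_mul, Matrix.mul_one]
    ext i j
    rcases i with i | i <;> rcases j with j | j
    · simp only [Matrix.submatrix_apply, Matrix.of_apply, he, Fin.val_succ,
        Matrix.fromBlocks_apply₁₁]
      rw [show (i : ℕ) + 1 + (j + 1) = i + j + 1 + 1 by ring, hb, eval_one_eulerPolynomial_succ,
        ← sum_tanhArray_odd i j n j.2, Finset.sum_div, Finset.sum_range, Matrix.mul_apply]
      refine Finset.sum_congr rfl fun k _ => ?_
      rw [Matrix.mul_diagonal]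
      simp only [B, d, Matrix.of_apply, Matrix.transpose_apply]
      ring
    · simp [he, he₀, hrow, Matrix.mul_apply]
    · simp [he, he₀, hrow, Matrix.mul_apply]
    · simp [he₀, hb₀]
  have hsum : ∑ k, (d k)⁻¹ = -harmonic n := by
    simp only [d, harmonic, Finset.sum_range, inv_neg, Finset.sum_neg_distrib]
    push_cast
    rfl
  have hprod : ∏ k, d k = (-1) ^ n * n.factorial := by
    rw [← Finset.prod_range_add_one_eq_factorial, Finset.prod_range]
    simp only [d, Finset.prod_neg, Finset.card_univ, Fintype.card_fin]
    push_cast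
    rfl
  rw [hankelDet, ← Matrix.det_submatrix_equiv_self e, hM, Matrix.det_mul, Matrix.det_mul,
    Matrix.det_transpose, det_bordered_diagonal d hd, Matrix.det_fromBlocks_zero₁₂, hB, hsum,
    hprod, Matrix.det_one, Finset.prod_pow, Finset.prod_range]
  ring

theorem prod_factorial_odd_eq (n : ℕ) :
    (n.factorial : ℚ) *
        ∏ k ∈ Finset.range n, (((2 * k + 1).factorial : ℚ) / 2 ^ (2 * k + 1)) ^ 2 =
      2 ^ (2 * n + 1) / ((2 * n + 1).factorial : ℚ) *
        ∏ k ∈ Finset.range (n + 1),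
          (2 * k + 1 : ℚ) / 2 * ((2 * k).factorial / 2 ^ (2 * k)) ^ 2 := by
  induction n with
  | zero => simp
  | succ n ih =>
    rw [Finset.prod_range_succ, Finset.prod_range_succ _ (n + 1), Nat.factorial_succ]
    have h1 : ((2 * (n + 1) + 1).factorial : ℚ) =
        (2 * n + 3) * (2 * n + 2) * (2 * n + 1).factorial := by
      rw [show 2 * (n + 1) + 1 = 2 * n + 1 + 1 + 1 by ring, Nat.factorial_succ, Nat.factorial_succ]
      push_cast
      ring
    have h2 : ((2 * (n + 1)).factorial : ℚ) = (2 * n + 2) * (2 * n + 1).factorial := by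
      rw [show 2 * (n + 1) = 2 * n + 1 + 1 by ring, Nat.factorial_succ]
      push_cast
      ring
    have h3 : ((2 * n + 1).factorial : ℚ) ≠ 0 := by positivity
    rw [h1, h2]
    push_cast
    have h4 : (2 * n + 3 : ℚ) ≠ 0 := by positivity
    have h5 : (2 * n + 2 : ℚ) ≠ 0 := by positivity
    set P := ∏ k ∈ Finset.range n, (((2 * k + 1).factorial : ℚ) / 2 ^ (2 * k + 1)) ^ 2
    set Q := ∏ k ∈ Finset.range (n + 1),
          (2 * k + 1 : ℚ) / 2 * ((2 * k).factorial / 2 ^ (2 * k)) ^ 2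
    calc _ = (n + 1 : ℚ) * (((2 * n + 1).factorial : ℚ) / 2 ^ (2 * n + 1)) ^ 2 *
          (n.factorial * P) := by ring
      _ = _ := by
        rw [ih, mul_add_one, pow_add, pow_add, pow_add]
        field_simp
        ring

theorem proposition3p3 (b : ℕ → ℚ) (hb₀ : b 0 = 0)
    (hb : ∀ k : ℕ, 1 ≤ k → b k = (eulerPolynomial (2 * k - 1)).eval 1) (n : ℕ) :
    hankelDet b n =
      (-1) ^ n * ((2 : ℚ) ^ (2 * n + 1) / ((2 * n + 1).factorial : ℚ)) * harmonic n *
        hankelDet (fun k => (eulerPolynomial (2 * k + 1)).eval 1) n := by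
  rw [hankelDet_eulerPolynomial_shift b hb₀ (fun k => hb (k + 1) (by omega)),
    hankelDet_eulerPolynomial_odd]
  linear_combination (-1) ^ n * harmonic n * prod_factorial_odd_eq n
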